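/- Let $K$ be an algebraically closed field, $n=s+m$, and $W=\operatorname{Spec}K[x,y]_y=\operatorname{Spec}K[x_1,\dots,x_s,y_1,\dots,y_m]_{y_1\cdots y_m}$. Let the torus $\mathbb T=(K^*)^d$ act on $W$ diagonally with weights $a_1,\dots,a_n\in\mathbb Z^d$, $T_t(\xi)=(t^{a_1}\xi_1,\dots,t^{a_n}\xi_n)$. An ideal $J\subset K[x,y]_y$ is called torus-stable if $f\circ T_t\in J$ for all $f\in J$, $t\in\mathbb T$. For a closed point $P$ of $W$, or of a variety $W'$ obtained from $W$ by blowing up, and $\lambda_1,\dots,\lambda_q\in\mathbb N^n$, we say that $J$ is monomial at $P$ with exponents $\lambda_1,\dots,\lambda_q$ if there are local coordinates $z=(z_1,\dots,z_n)$ in the completed local ring $\widehat{\mathcal O}_P$ (elements generating its maximal ideal) with $J\cdot\widehat{\mathcal O}_P=\langle z^{\lambda_1},\dots,z^{\lambda_q}\rangle$. (1) Let $J=\langle x^{\beta_1}(1-\mu_1y^{\delta_1}),\dots,x^{\beta_r}(1-\mu_ry^{\delta_r}),\epsilon x^{\beta_{r+1}}\rangle\subset K[x,y]_y$ be torus-stable,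 where $\beta_i\in\mathbb N^s$, $\mu_i\in K$, $\delta_i\in\mathbb Z^m$, $\epsilon\in\{0,1\}$. Then for every closed point $\xi\in W$, every $t\in\mathbb T$ and all $\lambda_1,\dots,\lambda_q\in\mathbb N^n$: $J$ is monomial at $\xi$ with exponents $\lambda_1,\dots,\lambda_q$ if and only if it is monomial at $T_t(\xi)$ with the same exponents. (2) Let $J\subset K[x,y]_y$ be any torus-stable ideal, and let $$W=W^{(0)}\leftarrow W^{(1)}\leftarrow\cdots\leftarrow W^{(N)}$$ be any sequence of blow-ups along combinatorial centers: $Z^{(k)}\subset W^{(k)}$ is an intersection of (one or more) components of the normal crossing divisor $E^{(k)}$, where $E^{(0)}=\{V(x_1),\dots,V(x_s)\}$ and $E^{(k+1)}$ consists of the strict transforms of the components of $E^{(k)}$ and of the exceptional divisor. Then the torus action lifts to algebraic actions on all $W^{(k)}$, given in the affine charts $\operatorname{Spec}K[u_1,\dots,u_s,y_1,\dots,y_m]_y$ of $W^{(k)}$ by $\xi\mapsto(t^{b_1}\xi_1,\dots,t^{b_n}\xi_n)$ with $b_i\in\mathbb Z^d$; the blow-ups are equivariant; all components of the divisors $E^{(k)}$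 (in particular the exceptional divisors), all centers $Z^{(k)}$ and all total transforms $J\mathcal O_{W^{(k)}}$ are invariant; and for every closed point $P\in W^{(k)}$, $J\mathcal O_{W^{(k)}}$ is monomial at $P$ with exponents $\lambda_1,\dots,\lambda_q$ if and only if it is monomial at $T_t(P)$ with the same exponents. In particular this holds for every locally monomial resolution of a torus-stable binomial ideal $J$, that is, for a sequence as in (2) such that $J\mathcal O_{W^{(N)}}$ is locally of the form in (1). (If a center has several connected components, they are blown up one after the other.) The combinatorial resolution algorithm for binomial ideals produces such a sequence, so its output is torus-equivariant. -/

import Mathlib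

open scoped BigOperators

namespace BinomialTorus

noncomputable section

/-! ### The field of rational functions and the torus -/

/-- The field `K(x, y)`, with `x = (x_1, …, x_s)` and `y = (y_1, …, y_m)`, that is, the function
field of `Spec K[x, y]_y` and of everything obtained from it by blowing up.  The variables `x_i`
are indexed by `Sum.inl i`, the variables `y_j` by `Sum.inr j`. -/
abbrev FunField (K : Type*) [Field K] (s m : ℕ) : Type _ :=
  FractionRing (MvPolynomial (Fin s ⊕ Fin m) K)

section

variable {K : Type*} [Field K] {s m d : ℕ}

variable (K m) in
/-- The variable `x_i`. -/
def xvar (i : Fin s) : FunField K s m :=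
  algebraMap (MvPolynomial (Fin s ⊕ Fin m) K) (FunField K s m) (MvPolynomial.X (Sum.inl i))

variable (K s) in
/-- The variable `y_j`. -/
def yvar (j : Fin m) : FunField K s m :=
  algebraMap (MvPolynomial (Fin s ⊕ Fin m) K) (FunField K s m) (MvPolynomial.X (Sum.inr j))

/-- The character `t ↦ t^w = t_1^{w_1} ⋯ t_d^{w_d}` of the torus `(Kˣ)^d`. -/
def character (t : Fin d → Kˣ) (w : Fin d → ℤ) : Kˣ := ∏ k, t k ^ w k

/-- The `K`-algebra endomorphism of the polynomial ring that multiplies every variable `X_i` by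
the constant `u_i`. -/
def scaleHom {σ : Type*} (u : σ → Kˣ) : MvPolynomial σ K →ₐ[K] MvPolynomial σ K :=
  MvPolynomial.aeval fun i => (u i : K) • MvPolynomial.X i

theorem scaleHom_X {σ : Type*} (u : σ → Kˣ) (i : σ) :
    scaleHom u (MvPolynomial.X i) = (u i : K) • MvPolynomial.X i :=
  MvPolynomial.aeval_X _ _

theorem scaleHom_comp {σ : Type*} (u v : σ → Kˣ) :
    (scaleHom u).comp (scaleHom v) = scaleHom (u * v) := by
  apply MvPolynomial.algHom_ext
  intro i
  rw [AlgHom.comp_apply, scaleHom_X, map_smul, scaleHom_X, scaleHom_X, smul_smul, Pi.mul_apply,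
    Units.val_mul, mul_comm]

theorem scaleHom_one {σ : Type*} : scaleHom (1 : σ → Kˣ) = AlgHom.id K _ := by
  apply MvPolynomial.algHom_ext
  intro i
  rw [scaleHom_X, Pi.one_apply, Units.val_one, one_smul, AlgHom.id_apply]

/-- `scaleHom` as a homomorphism to the group of automorphisms. -/
def scaleEquiv {σ : Type*} : (σ → Kˣ) →* (MvPolynomial σ K ≃ₐ[K] MvPolynomial σ K) where
  toFun u := AlgEquiv.ofAlgHom (scaleHom u) (scaleHom u⁻¹)
    (by rw [scaleHom_comp, mul_inv_cancel, scaleHom_one])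
    (by rw [scaleHom_comp, inv_mul_cancel, scaleHom_one])
  map_one' := AlgEquiv.ext fun p => DFunLike.congr_fun scaleHom_one p
  map_mul' u v := AlgEquiv.ext fun p => (DFunLike.congr_fun (scaleHom_comp u v) p).symm

/-- The characters of all weights together, as a homomorphism of tori. -/
def characters {σ : Type*} (a : σ → Fin d → ℤ) : (Fin d → Kˣ) →* (σ → Kˣ) where
  toFun t i := character t (a i)
  map_one' := by
    funext i
    simp [character]
  map_mul' t t' := by
    funext i
    simp [character, mul_zpow, Finset.prod_mul_distrib]

/-- The action of the diagonal torus `(Kˣ)^d` with weights `a` on rational functions.  The torus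
acts on points by `T_t(ξ) = (t^{a_1} ξ_1, …, t^{a_n} ξ_n)`, and `torusAut a t` is the pull-back
`f ↦ f ∘ T_t`, so it sends each variable to its multiple by the character of its weight. -/
def torusAut (a : Fin s ⊕ Fin m → Fin d → ℤ) :
    (Fin d → Kˣ) →* (FunField K s m ≃ₐ[K] FunField K s m) :=
  ((IsFractionRing.fieldEquivOfAlgEquivHom K (FunField K s m)).comp scaleEquiv).comp
    (characters a)

theorem torusAut_algebraMap (a : Fin s ⊕ Fin m → Fin d → ℤ) (t : Fin d → Kˣ)
    (i : Fin s ⊕ Fin m) :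
    torusAut a t (algebraMap (MvPolynomial (Fin s ⊕ Fin m) K) (FunField K s m)
        (MvPolynomial.X i)) =
      (character t (a i) : K) •
        algebraMap (MvPolynomial (Fin s ⊕ Fin m) K) (FunField K s m) (MvPolynomial.X i) := by
  have h := IsFractionRing.fieldEquivOfAlgEquiv_algebraMap K (FunField K s m) (FunField K s m)
    (scaleEquiv (characters a t)) (MvPolynomial.X i)
  refine h.trans ?_
  have h2 : scaleEquiv (characters a t) (MvPolynomial.X i) =
      (character t (a i) : K) • (MvPolynomial.X i : MvPolynomial (Fin s ⊕ Fin m) K) :=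
    scaleHom_X _ i
  rw [h2, Algebra.smul_def, Algebra.smul_def, map_mul, ← IsScalarTower.algebraMap_apply]

theorem torusAut_xvar (a : Fin s ⊕ Fin m → Fin d → ℤ) (t : Fin d → Kˣ) (i : Fin s) :
    torusAut a t (xvar K m i) = (character t (a (Sum.inl i)) : K) • xvar K m i :=
  torusAut_algebraMap a t _

theorem torusAut_yvar (a : Fin s ⊕ Fin m → Fin d → ℤ) (t : Fin d → Kˣ) (j : Fin m) :
    torusAut a t (yvar K s j) = (character t (a (Sum.inr j)) : K) • yvar K s j :=
  torusAut_algebraMap a t _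

/-! ### Affine charts, closed points, local rings -/

variable (K s m) in
/-- An affine chart `Spec K[u_1, …, u_s, y_1, …, y_m]_y`: its coordinates `u_i` as rational
functions, and for every `i` the name `label i` of the component `V(u_i)` of the normal crossing
divisor `E`.  Names are natural numbers, the same in all charts. -/
structure Chart where
  coord : Fin s → FunField K s m
  label : Fin s → ℕ

/-- The coordinate ring `K[u, y]_y` of a chart, inside the function field. -/
def Chart.ring (c : Chart K s m) : Subalgebra K (FunField K s m) :=
  Algebra.adjoin K (Set.range c.coord ∪ Set.range (yvar K s) ∪ Set.range fun j => (yvar K s j)⁻¹)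

theorem Chart.coord_mem (c : Chart K s m) (i : Fin s) : c.coord i ∈ c.ring :=
  Algebra.subset_adjoin (Or.inl (Or.inl ⟨i, rfl⟩))

theorem Chart.yvar_mem (c : Chart K s m) (j : Fin m) : yvar K s j ∈ c.ring :=
  Algebra.subset_adjoin (Or.inl (Or.inr ⟨j, rfl⟩))

/-- The coordinate `u_i` as an element of the coordinate ring. -/
def Chart.u (c : Chart K s m) (i : Fin s) : c.ring := ⟨c.coord i, c.coord_mem i⟩

/-- The coordinate `y_j` as an element of the coordinate ring. -/
def Chart.y (c : Chart K s m) (j : Fin m) : c.ring := ⟨yvar K s j, c.yvar_mem j⟩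

/-- The closed points of a chart, as evaluation homomorphisms `K[u, y]_y → K`. -/
abbrev Chart.Point (c : Chart K s m) : Type _ := c.ring →ₐ[K] K

/-- `η = T_t(ξ)` in the coordinates of the chart `c`: the coordinates of `η` are
`t^{b_i} ξ_i`, where `b_i` is the weight of the `i`-th coordinate. -/
def Chart.IsTranslate (c : Chart K s m) (b : Fin s ⊕ Fin m → Fin d → ℤ) (t : Fin d → Kˣ)
    (ξ η : c.Point) : Prop :=
  (∀ i, η (c.u i) = character t (b (Sum.inl i)) * ξ (c.u i)) ∧
    ∀ j, η (c.y j) = character t (b (Sum.inr j)) * ξ (c.y j)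

/-- The local ring at a closed point of a chart, inside the function field. -/
def Chart.localRing (c : Chart K s m) (ξ : c.Point) : LocalSubring (FunField K s m) :=
  haveI : (RingHom.ker (ξ : c.ring →+* K)).IsPrime := RingHom.ker_isPrime _
  @LocalSubring.ofPrime (FunField K s m) _ c.ring.toSubring (RingHom.ker (ξ : c.ring →+* K)) this

variable (K s m) in
/-- The chart `W = Spec K[x, y]_y` with `E = {V(x_1), …, V(x_s)}`, named `0, …, s - 1`. -/
def baseChart : Chart K s m where
  coord := xvar K m
  label := Fin.val

/-- The ideal generated by an ideal `J ⊆ K[x, y]_y` in a ring `S` that contains `K[x, y]_y`. -/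
def extend (J : Ideal (baseChart K s m).ring) (S : Subring (FunField K s m)) : Ideal S :=
  Ideal.span {g : S | ∃ f ∈ J, (f : FunField K s m) = g}

/-- `J` is stable under the torus. -/
def IsTorusStable (a : Fin s ⊕ Fin m → Fin d → ℤ) (J : Ideal (baseChart K s m).ring) : Prop :=
  ∀ (t : Fin d → Kˣ) (f g : (baseChart K s m).ring),
    (g : FunField K s m) = torusAut a t f → f ∈ J → g ∈ J

/-- The ideal generated by `x^{β_i} (1 - μ_i y^{δ_i})` for `1 ≤ i ≤ r` and `ε x^{β_{r+1}}`
in `K[x, y]_y`. -/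
def simpleIdeal {r : ℕ} (β : Fin (r + 1) → Fin s → ℕ) (μ : Fin r → K) (δ : Fin r → Fin m → ℤ)
    (ε : K) : Ideal (baseChart K s m).ring :=
  Ideal.span
    ({g | ∃ i : Fin r, (g : FunField K s m) =
        (∏ k, xvar K m k ^ β i.castSucc k) * (1 - μ i • ∏ j, yvar K s j ^ δ i j)} ∪
      {g | (g : FunField K s m) = ε • ∏ k, xvar K m k ^ β (Fin.last r) k})

/-- The completion of a local ring. -/
abbrev Completion (P : LocalSubring (FunField K s m)) : Type _ :=
  AdicCompletion (IsLocalRing.maximalIdeal P.toSubring) P.toSubring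

/-- `z_1, …, z_n`, where `n = s + m` is the dimension, are local coordinates in the completion of
the local ring at a closed point: they generate its maximal ideal. -/
def IsLocalCoordinates (P : LocalSubring (FunField K s m)) (z : Fin (s + m) → Completion P) :
    Prop :=
  Ideal.span (Set.range z) =
    (IsLocalRing.maximalIdeal P.toSubring).map (algebraMap P.toSubring (Completion P))

/-- There are local coordinates `z` at the point with local ring `P` such that the ideal generated
by `J` in the completed local ring is `⟨z^{λ_1}, …, z^{λ_q}⟩`. -/
def IsMonomialAt (J : Ideal (baseChart K s m).ring) (P : LocalSubring (FunField K s m))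
    {q : ℕ} (lam : Fin q → Fin (s + m) → ℕ) : Prop :=
  ∃ z : Fin (s + m) → Completion P, IsLocalCoordinates P z ∧
    (extend J P.toSubring).map (algebraMap P.toSubring (Completion P)) =
      Ideal.span (Set.range fun i => ∏ k, z k ^ lam i k)

/-! ### Blow-ups along combinatorial centers -/

/-- The stratum `Z = ⋂_{e ∈ I} V_e` meets the chart. -/
def Chart.Meets (c : Chart K s m) (I : Finset ℕ) : Prop := ∀ e ∈ I, ∃ i, c.label i = e

/-- The `i`-th affine chart of the blow-up of the chart `c` along the stratum
`Z = V(u_j : label j ∈ I)`, where `label i ∈ I`.  Its coordinates are `u_j / u_i` for the other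
`j` with `label j ∈ I`, and `u_j` for all remaining `j`.  Now `u_i` defines the exceptional divisor,
which gets the new name `new`, and the other coordinates define the strict transforms of the
components that they defined before. -/
def Chart.blowUp (c : Chart K s m) (I : Finset ℕ) (new : ℕ) (i : Fin s) : Chart K s m where
  coord j := if c.label j ∈ I ∧ j ≠ i then c.coord j / c.coord i else c.coord j
  label j := if j = i then new else c.label j

variable (K s m) in
/-- The affine charts of `W^{(k)}`, where `W^{(0)} = Spec K[x, y]_y` and
`W^{(k+1)} → W^{(k)}` is the blow-up along `Z^{(k)} = ⋂_{e ∈ I k} V_e`.  The exceptional divisor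
of this blow-up is named `s + k`. -/
def charts (I : ℕ → Finset ℕ) : ℕ → Set (Chart K s m)
  | 0 => {baseChart K s m}
  | k + 1 =>
    {c | c ∈ charts I k ∧ ¬ c.Meets (I k)} ∪
      {c' | ∃ c ∈ charts I k, c.Meets (I k) ∧
        ∃ i, c.label i ∈ I k ∧ c' = c.blowUp (I k) (s + k) i}

variable (K s m) in
/-- The closed points of `W^{(k)}`.  A point is given by its local ring in the function field:
points of two charts are identified if and only if their local rings are the same.  The map
`W^{(k+1)} → W^{(k)}` sends a point `P'` to the point `P` that it dominates (`P ≤ P'`). -/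
def points (I : ℕ → Finset ℕ) (k : ℕ) : Set (LocalSubring (FunField K s m)) :=
  {P | ∃ c ∈ charts K s m I k, ∃ ξ : c.Point, P = c.localRing ξ}

variable (K s m) in
/-- The closed points of the component `V_e` of the normal crossing divisor `E^{(k)}`. -/
def component (I : ℕ → Finset ℕ) (k e : ℕ) : Set (LocalSubring (FunField K s m)) :=
  {P | ∃ c ∈ charts K s m I k, ∃ ξ : c.Point, P = c.localRing ξ ∧
    ∃ i, c.label i = e ∧ ξ (c.u i) = 0}

variable (K s m) in
/-- The closed points of the center `Z^{(k)} = ⋂_{e ∈ I k} V_e`. -/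
def center (I : ℕ → Finset ℕ) (k : ℕ) : Set (LocalSubring (FunField K s m)) :=
  {P | P ∈ points K s m I k ∧ ∀ e ∈ I k, P ∈ component K s m I k e}

/-- The point `T_t(P)`: the local ring at `T_t(P)` consists of the `f` such that `f ∘ T_t` is
in the local ring at `P`. -/
def translate (a : Fin s ⊕ Fin m → Fin d → ℤ) (t : Fin d → Kˣ)
    (P : LocalSubring (FunField K s m)) : LocalSubring (FunField K s m) :=
  P.map ((torusAut a t).symm : FunField K s m →+* FunField K s m)

/-- The action of the torus on `W^{(0)} = Spec K[x, y]_y` lifts to an algebraic action on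
`W^{(0)}, …, W^{(N)}`, for which the blow-ups are equivariant and the components of the
divisors `E^{(k)}`, the centers `Z^{(k)}`, the total transforms of `J` and the local monomial
forms of the total transforms of `J` are invariant. -/
structure IsEquivariantSequence (a : Fin s ⊕ Fin m → Fin d → ℤ)
    (J : Ideal (baseChart K s m).ring) (I : ℕ → Finset ℕ) (N : ℕ) : Prop where
  /-- Every chart is preserved, and the torus acts on it diagonally with integral weights. -/
  chart : ∀ k ≤ N, ∀ c ∈ charts K s m I k, ∃ b : Fin s ⊕ Fin m → Fin d → ℤ,
    (∀ j, b (Sum.inr j) = a (Sum.inr j)) ∧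
    ∀ (t : Fin d → Kˣ),
      (∀ i, torusAut a t (c.coord i) = (character t (b (Sum.inl i)) : K) • c.coord i) ∧
      ∀ ξ : c.Point, ∃ η : c.Point, c.IsTranslate b t ξ η ∧
        c.localRing η = translate a t (c.localRing ξ)
  /-- The torus acts on `W^{(k)}`. -/
  points : ∀ k ≤ N, ∀ (t : Fin d → Kˣ) (P : LocalSubring (FunField K s m)),
    P ∈ points K s m I k → translate a t P ∈ points K s m I k
  /-- The blow-up `W^{(k+1)} → W^{(k)}` is equivariant. -/
  blowDown : ∀ k < N, ∀ (t : Fin d → Kˣ) (P P' : LocalSubring (FunField K s m)),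
    P ∈ BinomialTorus.points K s m I k → P' ∈ BinomialTorus.points K s m I (k + 1) → P ≤ P' →
      translate a t P ≤ translate a t P'
  /-- The components of the normal crossing divisors, in particular the exceptional divisors,
  are invariant. -/
  component : ∀ k ≤ N, ∀ (e : ℕ) (t : Fin d → Kˣ) (P : LocalSubring (FunField K s m)),
    P ∈ component K s m I k e ↔ translate a t P ∈ component K s m I k e
  /-- The centers are invariant. -/
  center : ∀ k < N, ∀ (t : Fin d → Kˣ) (P : LocalSubring (FunField K s m)),
    P ∈ center K s m I k ↔ translate a t P ∈ center K s m I k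
  /-- The total transforms of `J` are invariant. -/
  totalTransform : ∀ k ≤ N, ∀ c ∈ charts K s m I k, ∀ (t : Fin d → Kˣ) (f g : c.ring.toSubring),
    (g : FunField K s m) = torusAut a t f →
      (f ∈ extend J c.ring.toSubring ↔ g ∈ extend J c.ring.toSubring)
  /-- The local monomial forms of the total transforms of `J` are invariant. -/
  monomial : ∀ k ≤ N, ∀ (t : Fin d → Kˣ), ∀ P ∈ BinomialTorus.points K s m I k,
    ∀ (q : ℕ) (lam : Fin q → Fin (s + m) → ℕ),
      IsMonomialAt J P lam ↔ IsMonomialAt J (translate a t P) lam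

end

end

end BinomialTorus

/-! The torus acts on the function field by `K`-automorphisms, and all charts and local rings are
subrings of that one field. Hence the action on every blow-up is already there, and only invariance
has to be checked.

Charts: blowing up replaces some coordinates by quotients `u_j / u_i`, and a quotient of
eigenvectors is an eigenvector. By induction every chart has eigencoordinates (`exists_hasWeights`),
so its ring is preserved. Precomposing a closed point with the pull-back then gives its translate,
both in coordinates and as a local ring (`localRing_comp_pullback`).

Monomial forms: the automorphism restricts to an isomorphism from the local ring at `P` to the one
at `T_t(P)`. Stability of `J` makes it carry the extension of `J` to the extension of `J`
(`map_translateEquiv_extend`). The induced map of completions sends local coordinates to local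
coordinates and monomials to the same monomials (`isMonomialAt_translate`). Both claims of the
theorem rest on this statement for arbitrary torus-stable ideals. Converse directions come from
`t⁻¹`. -/

namespace AdicCompletion

/-! ### Functoriality of adic completion -/

variable {R S : Type*} [CommRing R] [CommRing S]

/-- The homomorphism from an adic completion to the quotients of the target that is induced by a
ring homomorphism. -/
noncomputable def mapQuotient {I : Ideal R} {I' : Ideal S} (e : R →+* S) (h : I ≤ I'.comap e)
    (n : ℕ) : AdicCompletion I R →+* S ⧸ I' ^ n :=
  (Ideal.quotientMap (I' ^ n) e ((Ideal.pow_right_mono h n).trans (Ideal.le_comap_pow e n))).comp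
    (evalₐ I n : AdicCompletion I R →+* R ⧸ I ^ n)

theorem mapQuotient_mk {I : Ideal R} {I' : Ideal S} (e : R →+* S) (h : I ≤ I'.comap e) (n : ℕ)
    (x : AdicCauchySequence I R) :
    mapQuotient e h n (mk I R x) = Ideal.Quotient.mk (I' ^ n) (e (x.val n)) := by
  simp [mapQuotient]

theorem factorPow_comp_mapQuotient {I : Ideal R} {I' : Ideal S} (e : R →+* S)
    (h : I ≤ I'.comap e) {k n : ℕ} (hle : k ≤ n) :
    (Ideal.Quotient.factorPow I' hle).comp (mapQuotient e h n) = mapQuotient e h k := by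
  ext x
  obtain ⟨x, rfl⟩ := mk_surjective I R x
  rw [RingHom.comp_apply, mapQuotient_mk, mapQuotient_mk, Ideal.Quotient.factor_mk,
    Ideal.Quotient.eq, ← map_sub]
  -- The Cauchy condition puts the difference of the two terms in `I ^ k`, and `e` maps `I ^ k` into
  -- `I' ^ k`.
  exact (Ideal.pow_right_mono h k).trans (Ideal.le_comap_pow e k)
    (Ideal.Quotient.eq.1 (Ideal.mk_eq_mk I hle x))

/-- The homomorphism of adic completions induced by a ring homomorphism. -/
noncomputable def mapRingHom {I : Ideal R} {I' : Ideal S} (e : R →+* S) (h : I ≤ I'.comap e) :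
    AdicCompletion I R →+* AdicCompletion I' S :=
  liftRingHom I' (mapQuotient e h) (factorPow_comp_mapQuotient e h)

/-- This square is all that is needed about the completed map: it transports ideals extended from
the local ring, so bijectivity never has to be shown. -/
theorem mapRingHom_comp_algebraMap {I : Ideal R} {I' : Ideal S} (e : R →+* S)
    (h : I ≤ I'.comap e) :
    (mapRingHom e h).comp (algebraMap R (AdicCompletion I R)) =
      (algebraMap S (AdicCompletion I' S)).comp e := by
  ext1 x
  refine ext_evalₐ fun n => ?_
  refine (evalₐ_liftRingHom I' (mapQuotient e h) (factorPow_comp_mapQuotient e h) n _).trans ?_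
  simp [mapQuotient]

end AdicCompletion

theorem IsLocalRing.map_maximalIdeal_of_ringEquiv {R S : Type*} [CommRing R] [CommRing S]
    [IsLocalRing R] [IsLocalRing S] (e : R ≃+* S) :
    (maximalIdeal R).map (e : R →+* S) = maximalIdeal S := by
  have : ((maximalIdeal R).map (e : R →+* S)).IsMaximal := Ideal.map_isMaximal_of_equiv e
  exact eq_maximalIdeal this

namespace BinomialTorus

noncomputable section

variable {K : Type*} [Field K] {s m d : ℕ}

/-! ### Weights of the chart coordinates -/

theorem yvar_ne_zero (j : Fin m) : yvar K s j ≠ 0 := by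
  rw [yvar, ne_eq, IsFractionRing.to_map_eq_zero_iff]
  exact MvPolynomial.X_ne_zero _

theorem character_sub (t : Fin d → Kˣ) (v w : Fin d → ℤ) :
    character t (v - w) = character t v / character t w := by
  simp [character, zpow_sub, Finset.prod_mul_distrib, div_eq_mul_inv]

/-- The coordinates of the chart are eigenvectors of the torus, with weights `b`. -/
structure Chart.HasWeights (c : Chart K s m) (a b : Fin s ⊕ Fin m → Fin d → ℤ) : Prop where
  inr : ∀ j, b (Sum.inr j) = a (Sum.inr j)
  inl : ∀ (t : Fin d → Kˣ) (i : Fin s),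
    torusAut a t (c.coord i) = (character t (b (Sum.inl i)) : K) • c.coord i

theorem baseChart_hasWeights (a : Fin s ⊕ Fin m → Fin d → ℤ) :
    (baseChart K s m).HasWeights a a :=
  ⟨fun _ => rfl, torusAut_xvar a⟩

theorem Chart.HasWeights.blowUp {c : Chart K s m} {a b : Fin s ⊕ Fin m → Fin d → ℤ}
    (h : c.HasWeights a b) (I : Finset ℕ) (new : ℕ) (i : Fin s) :
    (c.blowUp I new i).HasWeights a
      (Sum.elim
        (fun j => if c.label j ∈ I ∧ j ≠ i then b (Sum.inl j) - b (Sum.inl i) else b (Sum.inl j))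
        (fun j => a (Sum.inr j))) := by
  refine ⟨fun _ => rfl, fun t j => ?_⟩
  by_cases hj : c.label j ∈ I ∧ j ≠ i
  · simp only [Chart.blowUp, Sum.elim_inl, if_pos hj, map_div₀, h.inl, character_sub,
      Units.val_div_eq_div_val, Algebra.smul_def]
    rw [mul_div_mul_comm]
  · simp only [Chart.blowUp, Sum.elim_inl, if_neg hj, h.inl]

theorem exists_hasWeights (a : Fin s ⊕ Fin m → Fin d → ℤ) (I : ℕ → Finset ℕ) (k : ℕ)
    (c : Chart K s m) (hc : c ∈ charts K s m I k) : ∃ b, c.HasWeights a b := by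
  induction k generalizing c with
  | zero =>
    obtain rfl : c = baseChart K s m := hc
    exact ⟨a, baseChart_hasWeights a⟩
  | succ k ih =>
    rcases hc with ⟨hc, -⟩ | ⟨c, hc, -, i, -, rfl⟩
    · exact ih c hc
    · obtain ⟨b, hb⟩ := ih c hc
      exact ⟨_, hb.blowUp _ _ _⟩

theorem Chart.HasWeights.torusAut_mem {c : Chart K s m} {a b : Fin s ⊕ Fin m → Fin d → ℤ}
    (h : c.HasWeights a b) (t : Fin d → Kˣ) {f : FunField K s m} (hf : f ∈ c.ring) :
    torusAut a t f ∈ c.ring := by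
  induction hf using Algebra.adjoin_induction with
  | mem x hx =>
    rcases hx with (⟨i, rfl⟩ | ⟨j, rfl⟩) | ⟨j, rfl⟩
    · rw [h.inl]
      exact c.ring.smul_mem (c.coord_mem i) _
    · rw [torusAut_yvar]
      exact c.ring.smul_mem (c.yvar_mem j) _
    · dsimp only
      rw [map_inv₀, torusAut_yvar, smul_inv₀]
      exact c.ring.smul_mem (Algebra.subset_adjoin (Or.inr ⟨j, rfl⟩)) _
  | algebraMap r => simp
  | add x y _ _ hx hy => rw [map_add]; exact add_mem hx hy
  | mul x y _ _ hx hy => rw [map_mul]; exact mul_mem hx hy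

/-! ### Closed points of a chart and their translates -/

/-- The pull-back `f ↦ f ∘ T_t` on the coordinate ring of a chart. -/
def Chart.HasWeights.pullback {c : Chart K s m} {a b : Fin s ⊕ Fin m → Fin d → ℤ}
    (h : c.HasWeights a b) (t : Fin d → Kˣ) : c.ring →ₐ[K] c.ring :=
  (((torusAut a t : FunField K s m ≃ₐ[K] FunField K s m) :
    FunField K s m →ₐ[K] FunField K s m).comp c.ring.val).codRestrict c.ring
      fun f => h.torusAut_mem t f.2

theorem Chart.HasWeights.coe_pullback {c : Chart K s m} {a b : Fin s ⊕ Fin m → Fin d → ℤ}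
    (h : c.HasWeights a b) (t : Fin d → Kˣ) (f : c.ring) :
    (h.pullback t f : FunField K s m) = torusAut a t f :=
  rfl

theorem torusAut_inv_apply (a : Fin s ⊕ Fin m → Fin d → ℤ) (t : Fin d → Kˣ)
    (f : FunField K s m) : torusAut a t⁻¹ f = (torusAut a t).symm f := by
  rw [map_inv]; rfl

theorem Chart.HasWeights.isTranslate {c : Chart K s m} {a b : Fin s ⊕ Fin m → Fin d → ℤ}
    (h : c.HasWeights a b) (t : Fin d → Kˣ) (ξ : c.Point) :
    c.IsTranslate b t ξ (ξ.comp (h.pullback t)) := by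
  refine ⟨fun i => ?_, fun j => ?_⟩
  · have : h.pullback t (c.u i) = (character t (b (Sum.inl i)) : K) • c.u i :=
      Subtype.ext (h.inl t i)
    rw [AlgHom.comp_apply, this, map_smul, smul_eq_mul]
  · have : h.pullback t (c.y j) = (character t (b (Sum.inr j)) : K) • c.y j := by
      rw [h.inr]
      exact Subtype.ext (torusAut_yvar a t j)
    rw [AlgHom.comp_apply, this, map_smul, smul_eq_mul]

/-- The coordinates determine a point: the value at `y_j⁻¹` is forced by `y_j * y_j⁻¹ = 1`. -/
theorem Chart.IsTranslate.unique {c : Chart K s m} {b : Fin s ⊕ Fin m → Fin d → ℤ}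
    {t : Fin d → Kˣ} {ξ η η' : c.Point} (h : c.IsTranslate b t ξ η)
    (h' : c.IsTranslate b t ξ η') : η = η' := by
  refine AlgHom.adjoin_ext ?_
  rintro x ((⟨i, rfl⟩ | ⟨j, rfl⟩) | ⟨j, rfl⟩)
  · exact (h.1 i).trans (h'.1 i).symm
  · exact (h.2 j).trans (h'.2 j).symm
  · have hy : η (c.y j) = η' (c.y j) := (h.2 j).trans (h'.2 j).symm
    have hu : c.y j * ⟨(yvar K s j)⁻¹, Algebra.subset_adjoin (Or.inr ⟨j, rfl⟩)⟩ = 1 :=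
      Subtype.ext (mul_inv_cancel₀ (yvar_ne_zero j))
    have h1 := congrArg η hu
    have h2 := congrArg η' hu
    rw [map_mul, map_one] at h1 h2
    rw [← hy] at h2
    exact mul_left_cancel₀ (left_ne_zero_of_mul_eq_one h1) (h1.trans h2.symm)

theorem Chart.mem_localRing (c : Chart K s m) (ξ : c.Point) (x : FunField K s m) :
    x ∈ (c.localRing ξ).toSubring ↔
      ∃ f g : c.ring, ξ g ≠ 0 ∧ x = (f : FunField K s m) / (g : FunField K s m) := by
  have : (RingHom.ker (ξ : c.ring →+* K)).IsPrime := RingHom.ker_isPrime _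
  let A : Subring (FunField K s m) := c.ring.toSubring
  let p : Ideal A := RingHom.ker (ξ : c.ring →+* K)
  have : p.IsPrime := this
  have key : x ∈ (LocalSubring.ofPrime A p).toSubring ↔
      ∃ f g : A, g ∉ p ∧ x = (f : FunField K s m) / (g : FunField K s m) := by
    constructor
    · intro hx
      obtain ⟨⟨f, g⟩, hfg⟩ :=
        IsLocalization.surj p.primeCompl (⟨x, hx⟩ : (LocalSubring.ofPrime A p).toSubring)
      have hg : ((g : A) : FunField K s m) ≠ 0 := fun h0 =>
        g.2 (by rw [show (g : A) = 0 from Subtype.ext h0]; exact p.zero_mem)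
      exact ⟨f, g, g.2, (eq_div_iff hg).2 (congrArg Subtype.val hfg)⟩
    · rintro ⟨f, g, hg, rfl⟩
      have hg0 : (g : FunField K s m) ≠ 0 := fun h0 =>
        hg (by rw [show g = 0 from Subtype.ext h0]; exact p.zero_mem)
      obtain ⟨v, hv⟩ := (IsLocalization.map_units (LocalSubring.ofPrime A p).toSubring
        (⟨g, hg⟩ : p.primeCompl)).exists_right_inv
      have hv' : (g : FunField K s m) * (v : FunField K s m) = 1 := congrArg Subtype.val hv
      rw [div_eq_mul_inv, ← eq_inv_of_mul_eq_one_right hv']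
      exact mul_mem (LocalSubring.le_ofPrime A p f.2) v.2
  exact key

/-! ### Translates of local rings -/

theorem mem_translate (a : Fin s ⊕ Fin m → Fin d → ℤ) (t : Fin d → Kˣ)
    (P : LocalSubring (FunField K s m)) (f : FunField K s m) :
    f ∈ (translate a t P).toSubring ↔ torusAut a t f ∈ P.toSubring := by
  refine ⟨?_, fun h => ⟨_, h, (torusAut a t).symm_apply_apply f⟩⟩
  rintro ⟨g, hg, rfl⟩
  simpa using hg

theorem translate_inv_translate (a : Fin s ⊕ Fin m → Fin d → ℤ) (t : Fin d → Kˣ)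
    (P : LocalSubring (FunField K s m)) : translate a t⁻¹ (translate a t P) = P := by
  refine LocalSubring.toSubring_injective (Subring.ext fun f => ?_)
  rw [mem_translate, mem_translate, torusAut_inv_apply, AlgEquiv.apply_symm_apply]

/-- Links the action on coordinates with the action on local rings. Fractions correspond because the
pull-back by `t⁻¹` inverts the pull-back by `t` on the chart ring. -/
theorem Chart.HasWeights.localRing_comp_pullback {c : Chart K s m}
    {a b : Fin s ⊕ Fin m → Fin d → ℤ} (h : c.HasWeights a b) (t : Fin d → Kˣ) (ξ : c.Point) :
    c.localRing (ξ.comp (h.pullback t)) = translate a t (c.localRing ξ) := by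
  refine LocalSubring.toSubring_injective (Subring.ext fun x => ?_)
  rw [mem_translate, Chart.mem_localRing, Chart.mem_localRing]
  constructor
  · rintro ⟨f, g, hg, rfl⟩
    exact ⟨h.pullback t f, h.pullback t g, hg, map_div₀ _ _ _⟩
  · rintro ⟨f, g, hg, hx⟩
    have hinv (f : c.ring) : h.pullback t (h.pullback t⁻¹ f) = f :=
      Subtype.ext (by
        rw [coe_pullback, coe_pullback, torusAut_inv_apply, AlgEquiv.apply_symm_apply])
    refine ⟨h.pullback t⁻¹ f, h.pullback t⁻¹ g, by rwa [AlgHom.comp_apply, hinv], ?_⟩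
    rw [coe_pullback, coe_pullback, ← map_div₀, ← hx, torusAut_inv_apply,
      AlgEquiv.symm_apply_apply]

theorem translate_mono (a : Fin s ⊕ Fin m → Fin d → ℤ) (t : Fin d → Kˣ)
    {P P' : LocalSubring (FunField K s m)} (h : P ≤ P') : translate a t P ≤ translate a t P' := by
  obtain ⟨hle, hloc⟩ := h
  have hle' : (translate a t P).toSubring ≤ (translate a t P').toSubring := fun f hf =>
    (mem_translate a t P' f).2 (hle ((mem_translate a t P f).1 hf))
  refine ⟨hle', ⟨fun f hf => ?_⟩⟩
  obtain ⟨g, hg⟩ := hf.exists_right_inv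
  have hfg : (f : FunField K s m) * (g : FunField K s m) = 1 := congrArg Subtype.val hg
  have hfg' : torusAut a t f * torusAut a t g = 1 := by rw [← map_mul, hfg, map_one]
  let f₁ : P.toSubring := ⟨torusAut a t f, (mem_translate a t P f).1 f.2⟩
  -- Locality of the inclusion is transported: `torusAut a t f` is a unit in `P'`, hence in `P` by
  -- domination, and its inverse there is moved back by `(torusAut a t).symm`.
  have hu : IsUnit (Subring.inclusion hle f₁) :=
    .of_mul_eq_one ⟨torusAut a t g, (mem_translate a t P' g).1 g.2⟩ (Subtype.ext hfg')
  obtain ⟨w, hw⟩ := (hloc.map_nonunit f₁ hu).exists_right_inv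
  have hw' : torusAut a t f * (w : FunField K s m) = 1 := congrArg Subtype.val hw
  refine .of_mul_eq_one ⟨(torusAut a t).symm w, w, w.2, rfl⟩ (Subtype.ext ?_)
  change (f : FunField K s m) * (torusAut a t).symm w = 1
  apply (torusAut a t).injective
  rw [map_mul, AlgEquiv.apply_symm_apply, hw', map_one]

/-! ### Torus-stable ideals and their monomial forms -/

theorem IsTorusStable.exists_mem {a : Fin s ⊕ Fin m → Fin d → ℤ}
    {J : Ideal (baseChart K s m).ring} (hJ : IsTorusStable a J) (t : Fin d → Kˣ)
    {f : (baseChart K s m).ring} (hf : f ∈ J) :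
    ∃ g ∈ J, (g : FunField K s m) = torusAut a t f :=
  ⟨(baseChart_hasWeights a).pullback t f, hJ t f _ rfl hf, rfl⟩

/-- Stability moves the generators coming from `J` among themselves. The subrings are left general
so that this serves both chart rings and local rings. -/
theorem IsTorusStable.map_extend {a : Fin s ⊕ Fin m → Fin d → ℤ}
    {J : Ideal (baseChart K s m).ring} (hJ : IsTorusStable a J) (t : Fin d → Kˣ)
    {S S' : Subring (FunField K s m)} (e : S →+* S')
    (he : ∀ f, (e f : FunField K s m) = torusAut a t f) :
    (extend J S).map e ≤ extend J S' := by
  rw [extend, Ideal.map_span, Ideal.span_le]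
  rintro _ ⟨g, ⟨f, hf, hfg⟩, rfl⟩
  obtain ⟨f', hf', hff'⟩ := hJ.exists_mem t hf
  exact Ideal.subset_span ⟨f', hf', by rw [hff', he, hfg]⟩

/-- The isomorphism `f ↦ f ∘ T_t⁻¹` from the local ring at `P` to the local ring at `T_t(P)`. -/
def translateEquiv (a : Fin s ⊕ Fin m → Fin d → ℤ) (t : Fin d → Kˣ)
    (P : LocalSubring (FunField K s m)) : P.toSubring ≃+* (translate a t P).toSubring :=
  P.toSubring.equivMapOfInjective ((torusAut a t).symm : FunField K s m →+* FunField K s m)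
    (torusAut a t).symm.injective

theorem coe_translateEquiv (a : Fin s ⊕ Fin m → Fin d → ℤ) (t : Fin d → Kˣ)
    (P : LocalSubring (FunField K s m)) (f : P.toSubring) :
    (translateEquiv a t P f : FunField K s m) = torusAut a t⁻¹ f :=
  (torusAut_inv_apply a t f).symm

theorem coe_translateEquiv_symm (a : Fin s ⊕ Fin m → Fin d → ℤ) (t : Fin d → Kˣ)
    (P : LocalSubring (FunField K s m)) (f : (translate a t P).toSubring) :
    ((translateEquiv a t P).symm f : FunField K s m) = torusAut a t f := by
  obtain ⟨g, rfl⟩ := (translateEquiv a t P).surjective f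
  rw [RingEquiv.symm_apply_apply, coe_translateEquiv, torusAut_inv_apply,
    AlgEquiv.apply_symm_apply]

theorem IsTorusStable.map_translateEquiv_extend {a : Fin s ⊕ Fin m → Fin d → ℤ}
    {J : Ideal (baseChart K s m).ring} (hJ : IsTorusStable a J) (t : Fin d → Kˣ)
    (P : LocalSubring (FunField K s m)) :
    (extend J P.toSubring).map (translateEquiv a t P : P.toSubring →+* _) =
      extend J (translate a t P).toSubring := by
  refine le_antisymm (hJ.map_extend t⁻¹ _ (coe_translateEquiv a t P)) ?_
  -- The inverse isomorphism also respects the extensions of `J`; mapping that inclusion forward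
  -- gives the missing one.
  have h := Ideal.map_mono (f := (translateEquiv a t P : P.toSubring →+* (translate a t P).toSubring))
    (hJ.map_extend t ((translateEquiv a t P).symm : (translate a t P).toSubring →+* P.toSubring)
      (coe_translateEquiv_symm a t P))
  rwa [Ideal.map_map, RingEquiv.comp_symm, Ideal.map_id] at h

theorem IsTorusStable.isMonomialAt_translate {a : Fin s ⊕ Fin m → Fin d → ℤ}
    {J : Ideal (baseChart K s m).ring} (hJ : IsTorusStable a J) (t : Fin d → Kˣ)
    {P : LocalSubring (FunField K s m)} {q : ℕ} {lam : Fin q → Fin (s + m) → ℕ}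
    (h : IsMonomialAt J P lam) : IsMonomialAt J (translate a t P) lam := by
  obtain ⟨z, hz, hJz⟩ := h
  let e : P.toSubring →+* (translate a t P).toSubring := translateEquiv a t P
  have he := IsLocalRing.map_maximalIdeal_of_ringEquiv (translateEquiv a t P)
  let φ : Completion P →+* Completion (translate a t P) :=
    AdicCompletion.mapRingHom e (Ideal.map_le_iff_le_comap.1 he.le)
  have hφ : φ.comp (algebraMap P.toSubring (Completion P)) =
      (algebraMap (translate a t P).toSubring (Completion (translate a t P))).comp e :=
    AdicCompletion.mapRingHom_comp_algebraMap e _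
  refine ⟨φ ∘ z, ?_, ?_⟩
  · have h := congrArg (Ideal.map φ) hz
    rw [Ideal.map_span, Ideal.map_map, hφ, ← Ideal.map_map, he, ← Set.range_comp] at h
    exact h
  · have h := congrArg (Ideal.map φ) hJz
    rw [Ideal.map_span, Ideal.map_map, hφ, ← Ideal.map_map, hJ.map_translateEquiv_extend,
      ← Set.range_comp] at h
    rw [h]
    congr 2
    funext i
    simp

theorem IsTorusStable.isMonomialAt_translate_iff {a : Fin s ⊕ Fin m → Fin d → ℤ}
    {J : Ideal (baseChart K s m).ring} (hJ : IsTorusStable a J) (t : Fin d → Kˣ)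
    (P : LocalSubring (FunField K s m)) {q : ℕ} (lam : Fin q → Fin (s + m) → ℕ) :
    IsMonomialAt J P lam ↔ IsMonomialAt J (translate a t P) lam := by
  refine ⟨hJ.isMonomialAt_translate t, fun h => ?_⟩
  rw [← translate_inv_translate a t P]
  exact hJ.isMonomialAt_translate t⁻¹ h

/-! ### Invariance of points, components, centers and total transforms -/

theorem translate_mem_points (a : Fin s ⊕ Fin m → Fin d → ℤ) (I : ℕ → Finset ℕ) (k : ℕ)
    (t : Fin d → Kˣ) {P : LocalSubring (FunField K s m)} (h : P ∈ points K s m I k) :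
    translate a t P ∈ points K s m I k := by
  obtain ⟨c, hc, ξ, rfl⟩ := h
  obtain ⟨b, hb⟩ := exists_hasWeights a I k c hc
  exact ⟨c, hc, _, (hb.localRing_comp_pullback t ξ).symm⟩

theorem translate_mem_component (a : Fin s ⊕ Fin m → Fin d → ℤ) (I : ℕ → Finset ℕ) (k e : ℕ)
    (t : Fin d → Kˣ) {P : LocalSubring (FunField K s m)} (h : P ∈ component K s m I k e) :
    translate a t P ∈ component K s m I k e := by
  obtain ⟨c, hc, ξ, rfl, i, hi, h0⟩ := h
  obtain ⟨b, hb⟩ := exists_hasWeights a I k c hc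
  exact ⟨c, hc, _, (hb.localRing_comp_pullback t ξ).symm, i, hi,
    -- Scaling a coordinate by a character preserves its vanishing.
    by rw [(hb.isTranslate t ξ).1 i, h0, mul_zero]⟩

theorem translate_mem_center (a : Fin s ⊕ Fin m → Fin d → ℤ) (I : ℕ → Finset ℕ) (k : ℕ)
    (t : Fin d → Kˣ) {P : LocalSubring (FunField K s m)} (h : P ∈ center K s m I k) :
    translate a t P ∈ center K s m I k :=
  ⟨translate_mem_points a I k t h.1, fun e he => translate_mem_component a I k e t (h.2 e he)⟩

theorem mem_iff_translate_mem (a : Fin s ⊕ Fin m → Fin d → ℤ)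
    {A : Set (LocalSubring (FunField K s m))}
    (hA : ∀ (t : Fin d → Kˣ) {P}, P ∈ A → translate a t P ∈ A) (t : Fin d → Kˣ)
    (P : LocalSubring (FunField K s m)) : P ∈ A ↔ translate a t P ∈ A := by
  refine ⟨hA t, fun h => ?_⟩
  rw [← translate_inv_translate a t P]
  exact hA t⁻¹ h

theorem IsTorusStable.mem_extend_of_hasWeights {a b : Fin s ⊕ Fin m → Fin d → ℤ}
    {J : Ideal (baseChart K s m).ring} (hJ : IsTorusStable a J) {c : Chart K s m}
    (hc : c.HasWeights a b) (t : Fin d → Kˣ) {f g : c.ring.toSubring}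
    (hfg : (g : FunField K s m) = torusAut a t f) (hf : f ∈ extend J c.ring.toSubring) :
    g ∈ extend J c.ring.toSubring := by
  let e : c.ring.toSubring →+* c.ring.toSubring := (hc.pullback t : c.ring →+* c.ring)
  have he : e f = g := Subtype.ext hfg.symm
  rw [← he]
  exact hJ.map_extend t e (fun _ => rfl) (Ideal.mem_map_of_mem e hf)

theorem IsTorusStable.isEquivariantSequence {a : Fin s ⊕ Fin m → Fin d → ℤ}
    {J : Ideal (baseChart K s m).ring} (hJ : IsTorusStable a J) (I : ℕ → Finset ℕ) (N : ℕ) :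
    IsEquivariantSequence a J I N where
  chart k _ c hc := by
    obtain ⟨b, hb⟩ := exists_hasWeights a I k c hc
    exact ⟨b, hb.inr, fun t => ⟨hb.inl t, fun ξ =>
      ⟨_, hb.isTranslate t ξ, hb.localRing_comp_pullback t ξ⟩⟩⟩
  points k _ t _ h := translate_mem_points a I k t h
  blowDown _ _ t _ _ _ _ h := translate_mono a t h
  component k _ e := mem_iff_translate_mem a (translate_mem_component a I k e)
  center k _ := mem_iff_translate_mem a (translate_mem_center a I k)
  totalTransform k _ c hc t f g hfg := by
    obtain ⟨b, hb⟩ := exists_hasWeights a I k c hc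
    refine ⟨hJ.mem_extend_of_hasWeights hb t hfg, hJ.mem_extend_of_hasWeights hb t⁻¹ ?_⟩
    rw [hfg, torusAut_inv_apply, AlgEquiv.symm_apply_apply]
  monomial _ _ t P _ _ lam := hJ.isMonomialAt_translate_iff t P lam

theorem IsTorusStable.existsUnique_isTranslate {a : Fin s ⊕ Fin m → Fin d → ℤ}
    {J : Ideal (baseChart K s m).ring} (hJ : IsTorusStable a J) (t : Fin d → Kˣ)
    (ξ : (baseChart K s m).Point) :
    ∃! η : (baseChart K s m).Point, (baseChart K s m).IsTranslate a t ξ η ∧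
      ∀ (q : ℕ) (lam : Fin q → Fin (s + m) → ℕ),
        IsMonomialAt J ((baseChart K s m).localRing ξ) lam ↔
          IsMonomialAt J ((baseChart K s m).localRing η) lam := by
  have hb := baseChart_hasWeights (K := K) a
  refine ⟨ξ.comp (hb.pullback t), ⟨hb.isTranslate t ξ, fun q lam => ?_⟩,
    -- Uniqueness comes from the coordinates alone.
    fun η hη => hη.1.unique (hb.isTranslate t ξ)⟩
  rw [hb.localRing_comp_pullback]
  exact hJ.isMonomialAt_translate_iff t _ lam

end

end BinomialTorus

theorem mainTheorem7 {K : Type*} [Field K] [IsAlgClosed K] (s m d : ℕ)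
    (a : Fin s ⊕ Fin m → Fin d → ℤ) :
    (∀ (r : ℕ) (β : Fin (r + 1) → Fin s → ℕ) (μ : Fin r → K) (δ : Fin r → Fin m → ℤ) (ε : K),
      (ε = 0 ∨ ε = 1) →
      BinomialTorus.IsTorusStable a (BinomialTorus.simpleIdeal β μ δ ε) →
      ∀ (t : Fin d → Kˣ) (ξ : (BinomialTorus.baseChart K s m).Point),
        ∃! η : (BinomialTorus.baseChart K s m).Point,
          (BinomialTorus.baseChart K s m).IsTranslate a t ξ η ∧
          ∀ (q : ℕ) (lam : Fin q → Fin (s + m) → ℕ),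
            BinomialTorus.IsMonomialAt (BinomialTorus.simpleIdeal β μ δ ε)
                ((BinomialTorus.baseChart K s m).localRing ξ) lam ↔
              BinomialTorus.IsMonomialAt (BinomialTorus.simpleIdeal β μ δ ε)
                ((BinomialTorus.baseChart K s m).localRing η) lam) ∧
    (∀ J : Ideal (BinomialTorus.baseChart K s m).ring, BinomialTorus.IsTorusStable a J →
      ∀ (N : ℕ) (I : ℕ → Finset ℕ), (∀ k < N, (I k).Nonempty) →
        BinomialTorus.IsEquivariantSequence a J I N) := by
  exact ⟨fun _ _ _ _ _ _ hJ t ξ => hJ.existsUnique_isTranslate t ξ,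
    fun _ hJ N I _ => hJ.isEquivariantSequence I N⟩
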